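/- Let $a>0$ and let Gödel spacetime $\mathscr M$ be $\mathbb R^4$ with global coordinates $(x_0,x_1,x_2,x_3)$ and the Lorentzian metric of signature $(+,-,-,-)$ $$ds^2=a^2\Bigl[dx_0^2-dx_1^2+\tfrac12 e^{2x_1}\,dx_2^2-dx_3^2+2e^{x_1}\,dx_0\,dx_2\Bigr].$$ A tangent vector $v$ is timelike if $\langle v,v\rangle>0$, and a closed timelike curve is a smooth periodic curve $\gamma:\mathbb R\to\mathscr M$ of some period $T>0$ whose tangent vector $\dot\gamma(s)$ is timelike for every $s$. Then for any two points $m_1,m_2\in\mathscr M$ there is a closed timelike curve that passes through both $m_1$ and $m_2$. -/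

import Mathlib

open scoped ContDiff Matrix

/-- The underlying manifold of Gödel spacetime: `ℝ⁴` with its global coordinates
`(x₀, x₁, x₂, x₃)`. The tangent space at each point is identified with `ℝ⁴`. -/
abbrev GodelSpacetime : Type := Fin 4 → ℝ

/-- The matrix `g_{μν}` of Gödel's metric of scale `a` (signature `(+,-,-,-)`) at the point `x`. -/
noncomputable def godelMetric (a : ℝ) (x : GodelSpacetime) : Matrix (Fin 4) (Fin 4) ℝ :=
  a ^ 2 • !![1, 0, Real.exp (x 1), 0;
             0, -1, 0, 0;
             Real.exp (x 1), 0, Real.exp (2 * x 1) / 2, 0;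
             0, 0, 0, -1]

/-- The scalar product `g_{μν}(x) v^μ w^ν` of two tangent vectors at `x`. -/
noncomputable def godelInner (a : ℝ) (x : GodelSpacetime) (v w : Fin 4 → ℝ) : ℝ :=
  v ⬝ᵥ (godelMetric a x *ᵥ w)

/-- A tangent vector `v` at `x` is timelike if `⟨v, v⟩ > 0` (signature `(+,-,-,-)`). -/
def IsGodelTimelike (a : ℝ) (x : GodelSpacetime) (v : Fin 4 → ℝ) : Prop :=
  0 < godelInner a x v v

/-- A closed timelike curve: a smooth curve `γ`, periodic with period `T > 0`, whose tangent
vector is timelike at every value of the parameter. (Smoothness and periodicity make the curve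
close up smoothly, so no corner and no reversal of time direction can occur.) -/
structure IsClosedTimelikeCurve (a : ℝ) (γ : ℝ → GodelSpacetime) (T : ℝ) : Prop where
  period_pos : 0 < T
  smooth : ContDiff ℝ ∞ γ
  periodic : Function.Periodic γ T
  timelike : ∀ s : ℝ, IsGodelTimelike a (γ s) (deriv γ s)

open Real

/-! Large enough circles in Gödel spacetime are closed timelike curves, and the isometries `(x₁, x₂)
↦ (x₁ + c, e⁻ᶜ x₂)` and translations in `x₀, x₂, x₃` carry one to any base point. Let the base point
drift from `p` to `q` and back while the circle is traversed `N` times. The circular velocity grows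
like `N` and the drift stays bounded, so a large `N` keeps the tangent timelike
(`perturbed_circle_pos`, `timelike_circlingCurve`). -/

theorem godelInner_self (a : ℝ) (x : GodelSpacetime) (v : Fin 4 → ℝ) :
    godelInner a x v v = a ^ 2 * ((v 0 + exp (x 1) * v 2) ^ 2 - v 1 ^ 2
      - (exp (x 1) * v 2) ^ 2 / 2 - v 3 ^ 2) := by
  have h : exp (2 * x 1) = exp (x 1) ^ 2 := by rw [← exp_nat_mul]; norm_num
  simp only [godelInner, godelMetric, h, dotProduct, Matrix.mulVec, Fin.sum_univ_four,
    Matrix.smul_apply, smul_eq_mul]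
  simp
  ring

/-- The slow motion from `p` (at `s = 0`) to `q` (at `s = π`) and back. -/
noncomputable def sweep (p q s : ℝ) : ℝ := p + (q - p) * ((1 - cos s) / 2)

theorem contDiff_sweep (p q : ℝ) : ContDiff ℝ ∞ (sweep p q) := by
  unfold sweep; fun_prop

theorem hasDerivAt_sweep (p q s : ℝ) :
    HasDerivAt (sweep p q) ((q - p) * (sin s / 2)) s := by
  have h := ((((hasDerivAt_cos s).const_sub 1).div_const 2).const_mul (q - p)).const_add p
  exact h.congr_deriv (by simp)

theorem abs_deriv_sweep_le (p q s : ℝ) : |(q - p) * (sin s / 2)| ≤ |q - p| := by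
  rw [abs_mul]
  refine mul_le_of_le_one_right (abs_nonneg _) ?_
  rw [abs_div, abs_two]
  linarith [abs_sin_le_one s]

theorem sweep_le (p q s : ℝ) : sweep p q s ≤ |p| + |q| := by
  have h1 := neg_one_le_cos s
  have h2 := cos_le_one s
  have e : sweep p q s = p * ((1 + cos s) / 2) + q * ((1 - cos s) / 2) := by
    unfold sweep; ring
  rw [e]
  nlinarith [le_abs_self p, le_abs_self q, abs_nonneg p, abs_nonneg q,
    mul_le_mul_of_nonneg_right (le_abs_self p) (by linarith : 0 ≤ (1 + cos s) / 2),
    mul_le_mul_of_nonneg_right (le_abs_self q) (by linarith : 0 ≤ (1 - cos s) / 2)]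

/-- A closed curve through `p` and `q`: it turns at frequency `N` around circles which are closed
timelike curves, while the circles are displaced slowly from `p` to `q` and back. -/
noncomputable def circlingCurve (p q : GodelSpacetime) (N s : ℝ) : GodelSpacetime :=
  ![sweep (p 0) (q 0) s - 2 * √2 * arctan (4 * sin (N * s) / (5 + 4 * cos (N * s))),
    sweep (p 1) (q 1) s - log ((41 + 40 * cos (N * s)) / 81),
    sweep (p 2) (q 2) s + 40 * √2 / 81 * (exp (-sweep (p 1) (q 1) s) * sin (N * s)),
    sweep (p 3) (q 3) s]

/-- The point `5 + 4 e^{it}` stays in the right half-plane, so the `arctan` in the time coordinate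
is its argument: smooth and without a jump after a full turn. -/
theorem five_add_cos_pos (t : ℝ) : 0 < 5 + 4 * cos t := by linarith [neg_one_le_cos t]

theorem radius_pos (t : ℝ) : 0 < 41 + 40 * cos t := by linarith [neg_one_le_cos t]

theorem contDiff_circlingCurve (p q : GodelSpacetime) (N : ℝ) :
    ContDiff ℝ ∞ (circlingCurve p q N) := by
  have hb := fun i => contDiff_sweep (p i) (q i)
  have hs : ContDiff ℝ ∞ fun s : ℝ => sin (N * s) := by fun_prop
  have hc : ContDiff ℝ ∞ fun s : ℝ => cos (N * s) := by fun_prop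
  rw [contDiff_pi]
  intro i
  fin_cases i
  · exact (hb 0).sub (contDiff_const.mul
      (((contDiff_const.mul hs).div (contDiff_const.add (contDiff_const.mul hc))
        fun s => (five_add_cos_pos _).ne').arctan))
  · exact (hb 1).sub (((contDiff_const.add (contDiff_const.mul hc)).div_const 81).log
      fun s => (div_pos (radius_pos _) (by norm_num)).ne')
  · exact (hb 2).add (contDiff_const.mul ((hb 1).neg.exp.mul hs))
  · exact hb 3

theorem hasDerivAt_circlingCurve (p q : GodelSpacetime) (N s : ℝ) :
    HasDerivAt (circlingCurve p q N)
      ![(q 0 - p 0) * (sin s / 2)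
          - 2 * √2 * (N * (20 * cos (N * s) + 16) / (41 + 40 * cos (N * s))),
        (q 1 - p 1) * (sin s / 2) + 40 * N * sin (N * s) / (41 + 40 * cos (N * s)),
        (q 2 - p 2) * (sin s / 2) + 40 * √2 / 81 * (exp (-sweep (p 1) (q 1) s)
          * (N * cos (N * s) - (q 1 - p 1) * (sin s / 2) * sin (N * s))),
        (q 3 - p 3) * (sin s / 2)] s := by
  have hb := fun i => hasDerivAt_sweep (p i) (q i) s
  have hN : HasDerivAt (fun s : ℝ => N * s) N s := by
    simpa using (hasDerivAt_id s).const_mul N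
  have hs := hN.sin
  have hc := hN.cos
  have h5 := five_add_cos_pos (N * s)
  have hD := radius_pos (N * s)
  have hsq := sin_sq_add_cos_sq (N * s)
  rw [hasDerivAt_pi]
  intro i
  fin_cases i
  · have h := (hb 0).sub ((((hs.const_mul 4).div ((hc.const_mul 4).const_add 5) h5.ne').arctan
      ).const_mul (2 * √2))
    refine h.congr_deriv ?_
    -- Here `41 + 40 cos t = |5 + 4 e^{it}|²`.
    have e : 1 + (4 * sin (N * s) / (5 + 4 * cos (N * s))) ^ 2
        = (41 + 40 * cos (N * s)) / (5 + 4 * cos (N * s)) ^ 2 := by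
      field_simp
      linear_combination 16 * hsq
    simp only [Matrix.cons_val_zero, Fin.zero_eta, Pi.div_apply]
    rw [e]
    congr 2
    rw [one_div_div, div_mul_div_comm, div_eq_div_iff (by positivity) hD.ne']
    linear_combination
      16 * N * (5 + 4 * cos (N * s)) ^ 2 * (41 + 40 * cos (N * s)) * hsq
  · have h := (hb 1).sub ((((hc.const_mul 40).const_add 41).div_const 81).log
      (div_pos hD (by norm_num)).ne')
    refine h.congr_deriv ?_
    simp
    field_simp
    ring
  · have h := (hb 2).add (((hb 1).neg.exp.mul hs).const_mul (40 * √2 / 81))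
    refine h.congr_deriv ?_
    simp
    ring
  · exact hb 3

theorem periodic_circlingCurve (p q : GodelSpacetime) (n : ℕ) :
    Function.Periodic (circlingCurve p q (2 * n)) (2 * π) := by
  intro s
  have h : (2 * n : ℝ) * (s + 2 * π) = 2 * n * s + (2 * n : ℕ) * (2 * π) := by push_cast; ring
  simp only [circlingCurve, sweep, h, cos_add_nat_mul_two_pi, sin_add_nat_mul_two_pi,
    cos_add_two_pi]

theorem circlingCurve_zero (p q : GodelSpacetime) (N : ℝ) : circlingCurve p q N 0 = p := by
  ext i
  fin_cases i <;> norm_num [circlingCurve, sweep] <;> rfl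

/-- The even frequency makes the circle complete whole turns by `s = π`, when the drift reaches `q`.
-/
theorem circlingCurve_pi (p q : GodelSpacetime) (n : ℕ) :
    circlingCurve p q (2 * n) π = q := by
  have h : (2 * n : ℝ) * π = n * (2 * π) := by ring
  have hs : sin ((2 * n : ℝ) * π) = 0 := by
    rw [h]; simpa using sin_add_nat_mul_two_pi 0 n
  have hc : cos ((2 * n : ℝ) * π) = 1 := by rw [h]; exact cos_nat_mul_two_pi n
  ext i
  fin_cases i <;> norm_num [circlingCurve, sweep, hs, hc] <;> rfl

/-- A perturbation of size `K` of the circle's velocity keeps it timelike when the frequency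
dominates `K`. -/
theorem perturbed_circle_pos {r N S C F G H J K : ℝ} (hr : r ^ 2 = 2) (hSC : S ^ 2 + C ^ 2 = 1)
    (hF : |F| ≤ K) (hG : |G| ≤ K) (hH : |H| ≤ K) (hJ : |J| ≤ K) (hK : K < N) :
    0 < (-32 * r * N + F) ^ 2 - (40 * N * S + G) ^ 2 - (40 * N * C + H) ^ 2 - J ^ 2 := by
  have sq : ∀ {x : ℝ}, |x| ≤ K → x ^ 2 ≤ K ^ 2 := fun h =>
    sq_le_sq' (by linarith [abs_le.1 h]) (abs_le.1 h).2
  have hN : K ^ 2 < N ^ 2 := by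
    have := (abs_nonneg F).trans hF
    nlinarith
  -- Young's inequality with weight 1/10 leaves `(1843.2 - 1760) N²` against errors of at most `32
  -- K²`.
  have h1 : (1 - 1 / 10) * 2048 * N ^ 2 - 9 * F ^ 2 ≤ (-32 * r * N + F) ^ 2 := by
    have e : (r * N) ^ 2 = 2 * N ^ 2 := by rw [mul_pow, hr]
    nlinarith [sq_nonneg (32 * (r * N) - 10 * F)]
  have h2 : (40 * N * S + G) ^ 2 ≤ 11 / 10 * 1600 * N ^ 2 * S ^ 2 + 11 * G ^ 2 := by
    nlinarith [sq_nonneg (40 * N * S - 10 * G)]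
  have h3 : (40 * N * C + H) ^ 2 ≤ 11 / 10 * 1600 * N ^ 2 * C ^ 2 + 11 * H ^ 2 := by
    nlinarith [sq_nonneg (40 * N * C - 10 * H)]
  have h4 : N ^ 2 * S ^ 2 + N ^ 2 * C ^ 2 = N ^ 2 := by rw [← mul_add, hSC, mul_one]
  linarith [sq hF, sq hG, sq hH, sq hJ, sq_nonneg K]

/-- In the orthonormal frame, up to the scale `a`, the velocity times `41 + 40 cos (N s)` is `(-32√2
N, 40 N sin (N s), 40 N cos (N s), 0)` plus drift terms bounded independently of `N`. -/
theorem timelike_circlingCurve {a : ℝ} (ha : 0 < a) {p q : GodelSpacetime} {M E N : ℝ}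
    (hM : ∀ i, |q i - p i| ≤ M) (hE : ∀ s, exp (sweep (p 1) (q 1) s) ≤ E)
    (hN : 200 * M + 81 * (E * M) < N) (s : ℝ) :
    IsGodelTimelike a (circlingCurve p q N s) (deriv (circlingCurve p q N) s) := by
  have hD := radius_pos (N * s)
  have hb : ∀ i, |(q i - p i) * (sin s / 2)| ≤ M := fun i =>
    (abs_deriv_sweep_le _ _ _).trans (hM i)
  have hM0 : 0 ≤ M := (abs_nonneg _).trans (hM 0)
  have hr : √2 ^ 2 = 2 := sq_sqrt (by norm_num)
  have hr0 : 1 ≤ √2 := one_le_sqrt.2 (by norm_num)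
  have hr2 : √2 ≤ 2 := by nlinarith
  have hexp : exp (sweep (p 1) (q 1) s - log ((41 + 40 * cos (N * s)) / 81))
      = 81 * exp (sweep (p 1) (q 1) s) / (41 + 40 * cos (N * s)) := by
    rw [exp_sub, exp_log (div_pos hD (by norm_num))]
    field_simp
  rw [IsGodelTimelike, (hasDerivAt_circlingCurve p q N s).deriv, godelInner_self]
  refine mul_pos (by positivity) ?_
  simp only [circlingCurve, Matrix.cons_val, hexp, exp_neg]
  have hEs := hE s
  have hEp := exp_pos (sweep (p 1) (q 1) s)
  have hSC := sin_sq_add_cos_sq (N * s)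
  have hS := abs_sin_le_one (N * s)
  have hC := cos_le_one (N * s)
  have hb0 := hb 0
  have hb1 := hb 1
  have hb2 := hb 2
  have hb3 := hb 3
  generalize (q 0 - p 0) * (sin s / 2) = b0 at *
  generalize (q 1 - p 1) * (sin s / 2) = b1 at *
  generalize (q 2 - p 2) * (sin s / 2) = b2 at *
  generalize (q 3 - p 3) * (sin s / 2) = b3 at *
  generalize exp (sweep (p 1) (q 1) s) = e at *
  generalize sin (N * s) = S at *
  generalize cos (N * s) = C at *
  generalize √2 = r at *
  have hDb : ∀ {b : ℝ}, |b| ≤ M → |(41 + 40 * C) * b| ≤ 81 * M := fun h => by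
    rw [abs_mul, abs_of_pos hD]
    exact mul_le_mul (by linarith) h (abs_nonneg _) (by norm_num)
  have heb : |e * b2| ≤ E * M := by
    rw [abs_mul, abs_of_pos hEp]
    exact mul_le_mul hEs hb2 (abs_nonneg _) (hEp.le.trans hEs)
  have hbS : |b1 * S| ≤ M := by
    rw [abs_mul]
    exact (mul_le_of_le_one_right (abs_nonneg _) hS).trans hb1
  have hrbS : |r * (b1 * S)| ≤ 2 * M := by
    rw [abs_mul, abs_of_pos (by linarith)]
    exact mul_le_mul hr2 hbS (abs_nonneg _) (by norm_num)
  have hreb : |r * (e * b2)| ≤ 2 * (E * M) := by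
    rw [abs_mul, abs_of_pos (by linarith)]
    exact mul_le_mul hr2 heb (abs_nonneg _) (by norm_num)
  have hEM : 0 ≤ E * M := (abs_nonneg _).trans heb
  have key := perturbed_circle_pos (r := r) (N := N) (S := S) (C := C)
    (F := (41 + 40 * C) * b0 + 81 * (e * b2) - 40 * (r * (b1 * S)))
    (G := (41 + 40 * C) * b1) (H := 81 / 2 * (r * (e * b2)) - 40 * (b1 * S))
    (J := (41 + 40 * C) * b3) (K := 200 * M + 81 * (E * M)) hr hSC
    (by
      have := abs_le.1 (hDb hb0)
      have := abs_le.1 heb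
      have := abs_le.1 hrbS
      rw [abs_le]; constructor <;> linarith)
    ((hDb hb1).trans (by linarith))
    (by
      have := abs_le.1 hreb
      have := abs_le.1 hbS
      rw [abs_le]; constructor <;> linarith)
    ((hDb hb3).trans (by linarith)) hN
  -- What remains is the algebra of clearing the common denominator.
  refine (div_pos key (pow_pos hD 2)).trans_eq ?_
  have hI : (41 + 40 * C) * (41 + 40 * C)⁻¹ = 1 := mul_inv_cancel₀ hD.ne'
  have e1 : 81 * e / (41 + 40 * C) * (b2 + 40 * r / 81 * (e⁻¹ * (N * C - b1 * S)))
      = r * (40 * N * C + (81 / 2 * (r * (e * b2)) - 40 * (b1 * S))) / (41 + 40 * C) := by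
    field_simp
    linear_combination (-81 * e * b2) * hr
  have e0 : b0 - 2 * r * (N * (20 * C + 16) / (41 + 40 * C))
      + r * (40 * N * C + (81 / 2 * (r * (e * b2)) - 40 * (b1 * S))) / (41 + 40 * C)
      = (-32 * r * N + ((41 + 40 * C) * b0 + 81 * (e * b2) - 40 * (r * (b1 * S))))
        / (41 + 40 * C) := by
    simp only [div_eq_mul_inv]
    linear_combination (-b0) * hI + 81 / 2 * e * b2 * (41 + 40 * C)⁻¹ * hr
  have e2 : b1 + 40 * N * S / (41 + 40 * C)
      = (40 * N * S + (41 + 40 * C) * b1) / (41 + 40 * C) := by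
    simp only [div_eq_mul_inv]
    linear_combination (-b1) * hI
  have e3 : b3 ^ 2 = ((41 + 40 * C) * b3) ^ 2 / (41 + 40 * C) ^ 2 := by
    rw [mul_pow, mul_div_cancel_left₀ _ (pow_pos hD 2).ne']
  rw [e1, e0, e2, e3]
  simp only [div_pow, mul_pow r, hr]
  ring

theorem mainTheorem2 (a : ℝ) (ha : 0 < a) (m₁ m₂ : GodelSpacetime) :
    ∃ (γ : ℝ → GodelSpacetime) (T : ℝ), IsClosedTimelikeCurve a γ T ∧
      (∃ s₁ : ℝ, γ s₁ = m₁) ∧ (∃ s₂ : ℝ, γ s₂ = m₂) := by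
  obtain ⟨n, hn⟩ := exists_nat_gt
    (200 * ‖m₂ - m₁‖ + 81 * (exp (|m₁ 1| + |m₂ 1|) * ‖m₂ - m₁‖))
  refine ⟨circlingCurve m₁ m₂ (2 * n), 2 * π,
    ⟨two_pi_pos, contDiff_circlingCurve _ _ _, periodic_circlingCurve _ _ _,
      timelike_circlingCurve ha (fun i => norm_le_pi_norm (m₂ - m₁) i)
        (fun s => exp_le_exp.2 (sweep_le _ _ s)) ?_⟩,
    ⟨0, circlingCurve_zero _ _ _⟩, ⟨π, circlingCurve_pi _ _ _⟩⟩
  linarith [(Nat.cast_nonneg n : (0 : ℝ) ≤ n)]
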